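/- Let $a<b$ be real, $m\ge 1$, and let $$\mathcal H^m[a,b]=\Big\{f:[a,b]\to\mathbb R:\ f^{(j)},\ 0\le j\le m-1,\ \text{are absolutely continuous and } \int_a^b (f^{(m)})^2<\infty\Big\}.$$ Let $(\mathrm L f)(t)=f^{(m)}(t)+\sum_{j=0}^{m-1}w_j(t)f^{(j)}(t)$ with $w_0,\dots,w_{m-1}:[a,b]\to\mathbb R$ continuous, and equip $\mathcal H^m[a,b]$ with the inner product $\langle f,g\rangle=\sum_{j=0}^{m-1}f^{(j)}(a)g^{(j)}(a)+\int_a^b(\mathrm Lf)(\mathrm Lg)$. Let $u_1,\dots,u_m$ be a basis of the set of all $\mu\in\mathcal H^m[a,b]$ with $\mathrm L\mu=0$ almost everywhere, let $W(x)=[u_i^{(j-1)}(x)]_{i,j=1}^m$ be the Wronskian matrix, let $(u_1^*(x),\dots,u_m^*(x))$ be the last row of $W(x)^{-1}$, and put $$\mathcal G(t,x)=\begin{cases}\sum_{i=1}^m u_i(t)u_i^*(x), & x\le t,\\ 0,& x>t,\end{cases}\qquad R_1(s,t)=\int_a^b \mathcal G(s,x)\,\mathcal G(t,x)\,dx .$$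 Let $n\ge 0$, $t_1,\dots,t_n\in[a,b]$, $Y_1,\dots,Y_n\in\mathbb R$, let $G$ be an arbitrary real-valued function of $(t_1,\dots,t_n,Y_1,\dots,Y_n,z_1,\dots,z_n)$, let $F_1,\dots,F_n$ be continuous linear functionals on $\mathcal H^m[a,b]$, and let $\lambda\ge 0$. Then: 1. $\mathcal G$ is a Green's function for $\mathrm L$: $f(t)=\int_a^b\mathcal G(t,x)(\mathrm Lf)(x)\,dx$ for all $t\in[a,b]$ and all $f\in\mathcal H^m[a,b]$ with $f^{(j)}(a)=0$ for $0\le j\le m-1$. 2. $R_1(\cdot,t)\in\mathcal H^m[a,b]$ for every $t\in[a,b]$, the functions $\eta_{j1}(t)=F_j(R_1(\cdot,t))$ belong to $\mathcal H^m[a,b]$, and the matrix $K$ with entries $K[j,k]=F_j(\eta_{k1})$ is symmetric and non-negative definite. 3. If $\lambda>0$, then every minimizer $\mu$ over $\mathcal H^m[a,b]$ of $$G(t_1,\dots,t_n,Y_1,\dots,Y_n,F_1(\mu),\dots,F_n(\mu))+\lambda\int_a^b(\mathrm L\mu)^2\qquad(\ast)$$ is of the form $\mu=\sum_{i=1}^m\alpha_iu_i+\sum_{j=1}^n\beta_j\eta_{j1}$,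 where $(\alpha,\beta)\in\mathbb R^m\times\mathbb R^n$ minimizes $$G(t_1,\dots,t_n,Y_1,\dots,Y_n,F_1(\mu),\dots,F_n(\mu))+\lambda\,\beta'K\beta,\qquad \mu=\sum_{i=1}^m\alpha_iu_i+\sum_{j=1}^n\beta_j\eta_{j1}.\qquad(\ast\ast)$$ 4. Conversely, for every $\lambda\ge 0$, if $(\alpha,\beta)$ minimizes $(\ast\ast)$ over $\mathbb R^m\times\mathbb R^n$, then $\mu=\sum_{i=1}^m\alpha_iu_i+\sum_{j=1}^n\beta_j\eta_{j1}$ minimizes $(\ast)$ over $\mathcal H^m[a,b]$. -/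

import Mathlib

open Set MeasureTheory

namespace DiffPenalty

/-- The `j`-th derivative on `[a, b]` (one-sided at the end points) of `f : [a, b] → ℝ`.
Only its values at points of `[a, b]` are ever used. -/
noncomputable def der {a b : ℝ} (hab : a < b) (j : ℕ) (f : Icc a b → ℝ) : ℝ → ℝ :=
  iteratedDerivWithin j (IccExtend hab.le f) (Icc a b)

/-- Membership in `H^m[a, b]`: the derivatives of order `j < m` exist and are absolutely continuous
on `[a, b]`, and the `m`-th derivative (which then exists almost everywhere) is square integrable. -/
def MemSobolev {a b : ℝ} (hab : a < b) (m : ℕ) (f : Icc a b → ℝ) : Prop :=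
  (∀ j < m, ContDiffOn ℝ j (IccExtend hab.le f) (Icc a b) ∧
    AbsolutelyContinuousOnInterval (der hab j f) a b) ∧
  MemLp (der hab m f) 2 (volume.restrict (Icc a b))

theorem der_add {a b : ℝ} (hab : a < b) {j : ℕ} {f g : Icc a b → ℝ}
    (hf : ContDiffOn ℝ j (IccExtend hab.le f) (Icc a b))
    (hg : ContDiffOn ℝ j (IccExtend hab.le g) (Icc a b)) :
    EqOn (der hab j (f + g)) (der hab j f + der hab j g) (Icc a b) := fun x hx =>
  iteratedDerivWithin_add hx (uniqueDiffOn_Icc hab) (hf x hx) (hg x hx)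

theorem der_smul {a b : ℝ} (hab : a < b) (j : ℕ) (c : ℝ) (f : Icc a b → ℝ) :
    der hab j (c • f) = c • der hab j f := by
  have h : IccExtend hab.le (c • f) = c • IccExtend hab.le f := rfl
  induction j with
  | zero =>
    simp only [der, iteratedDerivWithin_zero, h]
  | succ j ih =>
    unfold der at ih ⊢
    ext x
    rw [iteratedDerivWithin_succ, ih, Pi.smul_apply, iteratedDerivWithin_succ]
    exact derivWithin_const_smul_field c _

theorem absCont_congr {a b : ℝ} (hab : a < b) {f g : ℝ → ℝ} (h : EqOn f g (Icc a b))
    (hf : AbsolutelyContinuousOnInterval f a b) : AbsolutelyContinuousOnInterval g a b := by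
  rw [absolutelyContinuousOnInterval_iff] at hf ⊢
  intro ε hε
  obtain ⟨δ, hδ, H⟩ := hf ε hε
  refine ⟨δ, hδ, fun E hE hs => ?_⟩
  have := H E hE hs
  refine lt_of_eq_of_lt (Finset.sum_congr rfl fun i hi => ?_) this
  have h1 := hE.1 i hi
  rw [uIcc_of_le hab.le] at h1
  rw [h h1.1, h h1.2]

theorem MemSobolev.der_add_ae {a b : ℝ} {hab : a < b} {m : ℕ} {f g : Icc a b → ℝ}
    (hf : MemSobolev hab m f) (hg : MemSobolev hab m g) :
    der hab m (f + g) =ᵐ[volume.restrict (Icc a b)] der hab m f + der hab m g := by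
  cases m with
  | zero => exact Filter.EventuallyEq.of_eq (by simp only [der, iteratedDerivWithin_zero]; rfl)
  | succ m =>
    have key : ∀ {f}, MemSobolev hab (m + 1) f → ∀ᵐ x ∂(volume.restrict (Icc a b)),
        DifferentiableAt ℝ (der hab m f) x := fun {f} hf => by
      rw [ae_restrict_iff' measurableSet_Icc]
      simpa [uIcc_of_le hab.le] using (hf.1 m m.lt_succ_self).2.ae_differentiableAt
    filter_upwards [key hf, key hg, ae_restrict_mem measurableSet_Icc] with x h1 h2 hx
    simp only [der, iteratedDerivWithin_succ, Pi.add_apply]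
    have h3 := der_add hab (hf.1 m m.lt_succ_self).1 (hg.1 m m.lt_succ_self).1
    refine (derivWithin_congr h3 (h3 hx)).trans ?_
    exact derivWithin_add h1.differentiableWithinAt h2.differentiableWithinAt

/-- The space `H^m[a, b]`. -/
def Sobolev {a b : ℝ} (hab : a < b) (m : ℕ) : Submodule ℝ (Icc a b → ℝ) where
  carrier := {f | MemSobolev hab m f}
  add_mem' {f g} hf hg := by
    refine ⟨fun j hj => ⟨(hf.1 j hj).1.add (hg.1 j hj).1, ?_⟩, ?_⟩
    · exact absCont_congr hab (der_add hab (hf.1 j hj).1 (hg.1 j hj).1).symm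
        ((hf.1 j hj).2.add (hg.1 j hj).2)
    · exact (memLp_congr_ae (hf.der_add_ae hg)).2 (hf.2.add hg.2)
  zero_mem' := by
    have h : ∀ j, der hab j (0 : Icc a b → ℝ) = 0 := fun j => by
      simpa using der_smul hab j 0 (0 : Icc a b → ℝ)
    refine ⟨fun j _ => ⟨contDiffOn_const (c := (0 : ℝ)), ?_⟩, ?_⟩
    · rw [h]
      exact (contDiffOn_const (c := (0 : ℝ))).absolutelyContinuousOnInterval
    · rw [h]
      exact MemLp.zero
  smul_mem' c f hf := by
    refine ⟨fun j hj => ⟨(hf.1 j hj).1.const_smul c, ?_⟩, ?_⟩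
    · rw [der_smul]
      exact (hf.1 j hj).2.const_smul c
    · rw [der_smul]
      exact hf.2.const_smul c

/-- The differential operator `(L f)(t) = f^(m)(t) + ∑_{j < m} w_j(t) f^(j)(t)`, meaningful for
almost every `t ∈ [a, b]` when `f ∈ H^m[a, b]`. -/
noncomputable def diffOp {a b : ℝ} (hab : a < b) {m : ℕ} (w : Fin m → ℝ → ℝ)
    (f : Icc a b → ℝ) (t : ℝ) : ℝ :=
  der hab m f t + ∑ j : Fin m, w j t * der hab j f t

/-- The inner product `⟨f, g⟩ = ∑_{j < m} f^(j)(a) g^(j)(a) + ∫_a^b (L f)(L g)` on `H^m[a, b]`. -/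
noncomputable def innerL {a b : ℝ} (hab : a < b) {m : ℕ} (w : Fin m → ℝ → ℝ)
    (f g : Sobolev hab m) : ℝ :=
  ∑ j : Fin m, der hab j f a * der hab j g a + ∫ x in a..b, diffOp hab w f x * diffOp hab w g x

/-- The norm `‖f‖ = ⟨f, f⟩^(1/2)` on `H^m[a, b]`. -/
noncomputable def normL {a b : ℝ} (hab : a < b) {m : ℕ} (w : Fin m → ℝ → ℝ)
    (f : Sobolev hab m) : ℝ :=
  Real.sqrt (innerL hab w f f)

/-- Continuity of a linear functional on `H^m[a, b]` with respect to the norm `normL`. -/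
def ContinuousFunctional {a b : ℝ} (hab : a < b) {m : ℕ} (w : Fin m → ℝ → ℝ)
    (F : Sobolev hab m →ₗ[ℝ] ℝ) : Prop :=
  ∀ f, ∀ ε > 0, ∃ δ > 0, ∀ g, normL hab w (g - f) < δ → |F g - F f| < ε

/-- The Wronskian matrix `W(x)_{ij} = u_i^(j)(x)`, with `0 ≤ j < m`. -/
noncomputable def wronskian {a b : ℝ} (hab : a < b) {m : ℕ} (u : Fin m → Sobolev hab m) (x : ℝ) :
    Matrix (Fin m) (Fin m) ℝ :=
  Matrix.of fun i j => der hab j (u i) x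

/-- `G(t, x) = ∑ i, u_i(t) u*_i(x)` for `x ≤ t` and `0` otherwise, where `(u*_1, …, u*_m)(x)` is
the last row of the inverse of the Wronskian matrix `W(x)`. -/
noncomputable def green {a b : ℝ} (hab : a < b) {m : ℕ} (hm : 0 < m) (u : Fin m → Sobolev hab m)
    (t : Icc a b) (x : ℝ) : ℝ :=
  if x ≤ t then
    ∑ i, (u i : Icc a b → ℝ) t * (wronskian hab u x)⁻¹ ⟨m - 1, Nat.sub_lt hm one_pos⟩ i
  else 0

/-- `G` is a Green's function for `L`: `f(t) = ∫_a^b G(t, x) (L f)(x) dx` for every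
`f ∈ H^m[a, b]` with `f^(j)(a) = 0` for all `j < m`. -/
def IsGreenFunction {a b : ℝ} (hab : a < b) {m : ℕ} (w : Fin m → ℝ → ℝ)
    (G : Icc a b → ℝ → ℝ) : Prop :=
  ∀ f : Sobolev hab m, (∀ j < m, der hab j f a = 0) → ∀ t : Icc a b,
    IntervalIntegrable (fun x => G t x * diffOp hab w f x) volume a b ∧
      (f : Icc a b → ℝ) t = ∫ x in a..b, G t x * diffOp hab w f x

/-- The kernel `R₁(s, t) = ∫_a^b G(s, x) G(t, x) dx`. -/
noncomputable def kernelR {a b : ℝ} (hab : a < b) {m : ℕ} (hm : 0 < m)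
    (u : Fin m → Sobolev hab m) (s t : Icc a b) : ℝ :=
  ∫ x in a..b, green hab hm u s x * green hab hm u t x

/-- The objective `G(t₁, …, tₙ, Y₁, …, Yₙ, F₁(μ), …, Fₙ(μ)) + lam ∫_a^b (L μ)²`. -/
noncomputable def objective {a b : ℝ} (hab : a < b) {m : ℕ} (w : Fin m → ℝ → ℝ) {n : ℕ}
    (G : (Fin n → Icc a b) → (Fin n → ℝ) → (Fin n → ℝ) → ℝ) (t : Fin n → Icc a b) (Y : Fin n → ℝ)
    (F : Fin n → (Sobolev hab m →ₗ[ℝ] ℝ)) (lam : ℝ) (μ : Sobolev hab m) : ℝ :=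
  G t Y (fun j => F j μ) + lam * ∫ x in a..b, (diffOp hab w μ x) ^ 2

/-- The function `∑ i, α_i u_i + ∑ j, β_j η_j`. -/
noncomputable def combination {a b : ℝ} {hab : a < b} {m n : ℕ} (u : Fin m → Sobolev hab m)
    (η : Fin n → Sobolev hab m) (α : Fin m → ℝ) (β : Fin n → ℝ) : Sobolev hab m :=
  ∑ i, α i • u i + ∑ j, β j • η j

/-- The matrix `K_{jk} = F_j(η_k)`. -/
noncomputable def matrixK {a b : ℝ} {hab : a < b} {m n : ℕ}
    (F : Fin n → (Sobolev hab m →ₗ[ℝ] ℝ)) (η : Fin n → Sobolev hab m) :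
    Matrix (Fin n) (Fin n) ℝ :=
  Matrix.of fun j k => F j (η k)

/-- The objective `G(t₁, …, tₙ, Y₁, …, Yₙ, F₁(μ), …, Fₙ(μ)) + lam β' K β` in the coefficients
`p = (α, β)`, where `μ = ∑ i, α_i u_i + ∑ j, β_j η_j`. -/
noncomputable def finObjective {a b : ℝ} {hab : a < b} {m n : ℕ} (u : Fin m → Sobolev hab m)
    (G : (Fin n → Icc a b) → (Fin n → ℝ) → (Fin n → ℝ) → ℝ) (t : Fin n → Icc a b) (Y : Fin n → ℝ)
    (F : Fin n → (Sobolev hab m →ₗ[ℝ] ℝ)) (η : Fin n → Sobolev hab m) (lam : ℝ)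
    (p : (Fin m → ℝ) × (Fin n → ℝ)) : ℝ :=
  G t Y (fun j => F j (combination u η p.1 p.2)) +
    lam * (p.2 ⬝ᵥ (matrixK F η).mulVec p.2)

end DiffPenalty

open DiffPenalty

/-!
The argument reduces everything to the Hilbert space `L²[a, b]` through an integral operator
`T : L²[a, b] → H^m[a, b]`, `(T φ)(t) = ∫_a^b G(t, x) φ(x) dx`, which is the right inverse of `L`
with values in the functions whose derivatives of order `j < m` vanish at `a`
(`exists_greenOperator`).

Its construction is variation of constants. A solution of `L f = 0` satisfies a first-order system
with Lipschitz right-hand side, so it vanishes once its derivatives of order `j < m` vanish at one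
point (`eq_zero_of_diffOp_ae_eq_zero`). Hence the Wronskian matrix is invertible on `[a, b]` and
the `u*_i` are continuous. The last row of `W⁻¹ W = 1` says that `∑ i, u_i^(j) u*_i` is `0` for
`j + 1 < m` and `1` for `j + 1 = m`, so the functions `∑ i, u_i^(j) ∫_a^· u*_i φ` are absolutely
continuous, each being the derivative of the one before, and `L (T φ) = φ`
(`exists_sobolev_integral_green`). By uniqueness `f = T (L f)` when `f` has zero initial data, which
is the Green's function property.

On the range of `T` the norm of `H^m[a, b]` is the `L²` norm of `L f`, so the Riesz theorem gives
`ψ_j ∈ L²[a, b]` with `F_j (T φ) = ⟪ψ_j, φ⟫` (`exists_representer`). Since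
`R₁(·, s) = T (G(s, ·))`, this makes `η_j = T ψ_j`, and `K` is the Gram matrix of the `ψ_j`.

Finally every `μ` is a combination of the `u_i` and `η_j` plus some `T r` with `r` orthogonal to all
`ψ_j` (`exists_decomposition`). The summand `T r` does not change any `F_j (μ)` and adds exactly
`lam ‖r‖²` to the objective (`objective_combination_add`), whence the correspondence between the
minimizers of the two problems.
-/

namespace DiffPenalty

open scoped RealInnerProductSpace

variable {a b : ℝ} {hab : a < b} {m n : ℕ}

/-! ### Derivatives in `H^m[a, b]` -/

/-- An absolutely continuous function whose almost everywhere derivative agrees with a continuous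
function is continuously differentiable. -/
theorem hasDerivWithinAt_of_ae_hasDerivAt (hab : a < b) {h k : ℝ → ℝ}
    (hh : AbsolutelyContinuousOnInterval h a b) (hk : ContinuousOn k (Icc a b))
    (hd : ∀ᵐ x, x ∈ Icc a b → HasDerivAt h (k x) x) {x : ℝ} (hx : x ∈ Icc a b) :
    HasDerivWithinAt h (k x) (Icc a b) x := by
  set K : ℝ → ℝ := IccExtend hab.le ((Icc a b).domRestrict k) with hK
  have hKc : Continuous K := (continuousOn_iff_continuous_domRestrict.1 hk).Icc_extend'
  have hKk : ∀ y ∈ Icc a b, K y = k y := fun y hy => by rw [hK, IccExtend_of_mem _ _ hy]; rfl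
  have hrep : ∀ y ∈ Icc a b, h y = h a + ∫ s in a..y, K s := by
    intro y hy
    have h1 : uIcc a y ⊆ uIcc a b := by
      rw [uIcc_of_le hy.1, uIcc_of_le hab.le]; exact Icc_subset_Icc_right hy.2
    rw [← add_eq_of_eq_sub' (hh.mono h1).integral_deriv_eq_sub]
    congr 1
    refine intervalIntegral.integral_congr_ae ?_
    filter_upwards [hd] with s hs hs'
    have hs2 : s ∈ Icc a b := by
      have := h1 (uIoc_subset_uIcc hs'); rwa [uIcc_of_le hab.le] at this
    rw [(hs hs2).deriv, hKk s hs2]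
  have h2 : HasDerivAt (fun y => h a + ∫ s in a..y, K s) (K x) x :=
    (hKc.integral_hasStrictDerivAt a x).hasDerivAt.const_add _
  rw [← hKk x hx]
  exact h2.hasDerivWithinAt.congr hrep (hrep x hx)

theorem der_succ (hab : a < b) (j : ℕ) (f : Icc a b → ℝ) (x : ℝ) :
    der hab (j + 1) f x = derivWithin (der hab j f) (Icc a b) x := by
  simp only [der, iteratedDerivWithin_succ]

theorem der_zero (hab : a < b) (f : Icc a b → ℝ) (x : Icc a b) : der hab 0 f x = f x := by
  simp [der]

theorem MemSobolev.continuousOn_der {f : Icc a b → ℝ} (hf : MemSobolev hab m f) {j : ℕ}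
    (hj : j < m) : ContinuousOn (der hab j f) (Icc a b) := by
  have := (hf.1 j hj).2.continuousOn
  rwa [uIcc_of_le hab.le] at this

theorem MemSobolev.ae_hasDerivAt_der {f : Icc a b → ℝ} (hf : MemSobolev hab m f) {j : ℕ}
    (hj : j < m) : ∀ᵐ x, x ∈ Icc a b → HasDerivAt (der hab j f) (der hab (j + 1) f x) x := by
  have := (hf.1 j hj).2.ae_differentiableAt
  rw [uIcc_of_le hab.le] at this
  filter_upwards [this] with x hx hxI
  rw [der_succ, (hx hxI).derivWithin (uniqueDiffOn_Icc hab x hxI)]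
  exact (hx hxI).hasDerivAt

/-- A function belongs to `H^m` as soon as it starts a chain `g 0, …, g m` in which each function
is almost everywhere the derivative of the one before, `g 0, …, g (m - 1)` being absolutely
continuous and `g m` square integrable. The chain then consists of its derivatives. -/
theorem memSobolev_of_chain (hab : a < b) (m : ℕ) {f : Icc a b → ℝ} (g : ℕ → ℝ → ℝ)
    (h0 : ∀ x : Icc a b, f x = g 0 x)
    (hac : ∀ j < m, AbsolutelyContinuousOnInterval (g j) a b)
    (hd : ∀ j < m, ∀ᵐ x, x ∈ Icc a b → HasDerivAt (g j) (g (j + 1) x) x)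
    (hL : MemLp (g m) 2 (volume.restrict (Icc a b))) :
    MemSobolev hab m f ∧ (∀ j < m, EqOn (der hab j f) (g j) (Icc a b)) ∧
      der hab m f =ᵐ[volume.restrict (Icc a b)] g m := by
  have hcont : ∀ j < m, ContinuousOn (g j) (Icc a b) := fun j hj => by
    have := (hac j hj).continuousOn
    rwa [uIcc_of_le hab.le] at this
  have hder : ∀ j, j + 1 < m → ∀ x ∈ Icc a b, HasDerivWithinAt (g j) (g (j + 1) x) (Icc a b) x :=
    fun j hj x hx => hasDerivWithinAt_of_ae_hasDerivAt hab (hac j (by omega)) (hcont _ hj)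
      (hd j (by omega)) hx
  have hud := uniqueDiffOn_Icc hab
  have hzero : EqOn (der hab 0 f) (g 0) (Icc a b) := fun x hx => by
    rw [← h0 ⟨x, hx⟩]; exact der_zero hab f ⟨x, hx⟩
  have heq : ∀ j < m, EqOn (der hab j f) (g j) (Icc a b) := by
    intro j
    induction j with
    | zero => exact fun _ => hzero
    | succ j ih =>
      intro hj x hx
      have ih' := ih (by omega)
      rw [der_succ, derivWithin_congr ih' (ih' hx), (hder j hj x hx).derivWithin (hud x hx)]
  have hmeq : der hab m f =ᵐ[volume.restrict (Icc a b)] g m := by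
    cases m with
    | zero =>
      filter_upwards [ae_restrict_mem measurableSet_Icc] with x hx using hzero hx
    | succ k =>
      filter_upwards [(ae_restrict_iff' measurableSet_Icc).2 (hd k k.lt_succ_self),
        ae_restrict_mem measurableSet_Icc] with x hx hxI
      have ih' := heq k k.lt_succ_self
      rw [der_succ, derivWithin_congr ih' (ih' hxI),
        hx.hasDerivWithinAt.derivWithin (hud x hxI)]
  refine ⟨⟨fun j hj => ⟨?_, absCont_congr hab (heq j hj).symm (hac j hj)⟩,
    (memLp_congr_ae hmeq).2 hL⟩, heq, hmeq⟩
  refine contDiffOn_of_continuousOn_differentiableOn_deriv (n := (j : ℕ∞)) (fun i hi => ?_)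
    (fun i hi => ?_)
  · have hi' : i < m := lt_of_le_of_lt (by exact_mod_cast hi) hj
    exact (hcont i hi').congr (heq i hi')
  · have hi' : i < j := by exact_mod_cast hi
    exact fun x hx => ((hder i (by omega) x hx).congr (heq i (by omega))
      (heq i (by omega) hx)).differentiableWithinAt

/-! ### Uniqueness for the initial value problem -/

/-- The companion vector field of `L`: `y' = v(x, y)` is the first-order system satisfied by
`(f, f', …, f^(m-1))` when `L f = 0`. -/
noncomputable def companion (w : Fin m → ℝ → ℝ) (x : ℝ) (y : Fin m → ℝ) : Fin m → ℝ := fun j =>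
  if h : (j : ℕ) + 1 < m then y ⟨j + 1, h⟩ else -∑ i, w i x * y i

theorem companion_zero (w : Fin m → ℝ → ℝ) (x : ℝ) : companion w x 0 = 0 := by
  funext j; simp [companion]

theorem exists_lipschitzWith_companion {w : Fin m → ℝ → ℝ}
    (hw : ∀ j, ContinuousOn (w j) (Icc a b)) :
    ∃ C, ∀ x ∈ Icc a b, LipschitzWith C (companion w x) := by
  have hbd : ∀ i, ∃ B, ∀ x ∈ Icc a b, ‖w i x‖ ≤ B := fun i =>
    isCompact_Icc.exists_bound_of_continuousOn (hw i)
  choose B hB using hbd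
  refine ⟨Real.toNNReal (1 + ∑ i, |B i|), fun x hx => LipschitzWith.of_dist_le_mul fun y z => ?_⟩
  have hS : 0 ≤ ∑ i, |B i| := Finset.sum_nonneg fun i _ => abs_nonneg _
  rw [Real.coe_toNNReal _ (by positivity)]
  refine (dist_pi_le_iff (by positivity)).2 fun j => ?_
  have hyz : ∀ i, |y i - z i| ≤ dist y z := fun i => by
    rw [← Real.dist_eq]; exact dist_le_pi_dist y z i
  unfold companion
  split_ifs with h
  · refine (dist_le_pi_dist y z _).trans (le_mul_of_one_le_left dist_nonneg (by linarith))
  · have h1 : -∑ i, w i x * y i - -∑ i, w i x * z i = ∑ i, w i x * (z i - y i) := by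
      simp only [mul_sub, Finset.sum_sub_distrib]; ring
    rw [Real.dist_eq, h1]
    refine (Finset.abs_sum_le_sum_abs _ _).trans ?_
    calc ∑ i, |w i x * (z i - y i)| ≤ ∑ i, |B i| * dist y z := by
          refine Finset.sum_le_sum fun i _ => ?_
          rw [abs_mul, abs_sub_comm]
          exact mul_le_mul ((hB i x hx).trans (le_abs_self _)) (hyz i) (abs_nonneg _)
            (abs_nonneg _)
      _ = (∑ i, |B i|) * dist y z := by rw [Finset.sum_mul]
      _ ≤ _ := mul_le_mul_of_nonneg_right (by linarith) dist_nonneg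

/-- Uniqueness for the initial value problem: a solution of `L f = 0` whose derivatives of order
`j < m` all vanish at one point is zero. -/
theorem eq_zero_of_diffOp_ae_eq_zero {w : Fin m → ℝ → ℝ} (hm : 0 < m)
    (hw : ∀ j, ContinuousOn (w j) (Icc a b)) {f : Icc a b → ℝ} (hf : MemSobolev hab m f)
    (hL : ∀ᵐ x ∂(volume.restrict (Icc a b)), diffOp hab w f x = 0) {x₀ : ℝ} (hx₀ : x₀ ∈ Icc a b)
    (hzero : ∀ j < m, der hab j f x₀ = 0) : f = 0 := by
  obtain ⟨C, hC⟩ := exists_lipschitzWith_companion hw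
  set V : ℝ → Fin m → ℝ := fun x j => der hab j f x with hV
  have hVc : ContinuousOn V (Icc a b) := continuousOn_pi.2 fun j => hf.continuousOn_der j.2
  -- By `L f = 0` the almost everywhere derivative of `f^(m-1)` is continuous, so the system holds
  -- at every point.
  have hVd : ∀ x ∈ Icc a b, HasDerivWithinAt V (companion w x (V x)) (Icc a b) x := by
    refine fun x hx => hasDerivWithinAt_pi.2 fun j => ?_
    refine hasDerivWithinAt_of_ae_hasDerivAt hab (k := fun x => companion w x (V x) j)
      (hf.1 j j.2).2 ?_ ?_ hx
    · unfold companion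
      split_ifs with h
      · exact hf.continuousOn_der h
      · exact (continuousOn_finsetSum _ fun i _ => (hw i).mul (hf.continuousOn_der i.2)).neg
    · filter_upwards [hf.ae_hasDerivAt_der j.2, (ae_restrict_iff' measurableSet_Icc).1 hL]
        with y hy hy' hyI
      convert hy hyI using 1
      simp only [companion]
      split_ifs with h
      · rfl
      · have hjm : (j : ℕ) + 1 = m := by have := j.2; omega
        have := hy' hyI
        rw [diffOp] at this
        rw [hjm]
        linarith
  have hx₀V : V x₀ = 0 := funext fun j => hzero j j.2
  have hright : EqOn V 0 (Icc x₀ b) := by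
    refine ODE_solution_unique_of_mem_Icc_right (v := companion w) (s := fun _ => univ) (K := C)
      (fun t ht => (hC t ⟨hx₀.1.trans ht.1, ht.2.le⟩).lipschitzOnWith)
      (hVc.mono (Icc_subset_Icc_left hx₀.1)) (fun t ht => ?_) (fun _ _ => mem_univ _)
      continuousOn_const (fun t _ => ?_) (fun _ _ => mem_univ _) hx₀V
    · have ht' : t ∈ Icc a b := ⟨hx₀.1.trans ht.1, ht.2.le⟩
      refine (hVd t ht').mono_of_mem_nhdsWithin ?_
      exact Filter.mem_of_superset (Icc_mem_nhdsGE ht.2) (Icc_subset_Icc_left ht'.1)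
    · simp only [Pi.zero_apply, companion_zero]
      exact hasDerivWithinAt_const t (Ici t) (0 : Fin m → ℝ)
  have hleft : EqOn V 0 (Icc a x₀) := by
    refine ODE_solution_unique_of_mem_Icc_left (v := companion w) (s := fun _ => univ) (K := C)
      (fun t ht => (hC t ⟨ht.1.le, ht.2.trans hx₀.2⟩).lipschitzOnWith)
      (hVc.mono (Icc_subset_Icc_right hx₀.2)) (fun t ht => ?_) (fun _ _ => mem_univ _)
      continuousOn_const (fun t _ => ?_) (fun _ _ => mem_univ _) hx₀V
    · have ht' : t ∈ Icc a b := ⟨ht.1.le, ht.2.trans hx₀.2⟩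
      refine (hVd t ht').mono_of_mem_nhdsWithin ?_
      exact Filter.mem_of_superset (Icc_mem_nhdsLE ht.1) (Icc_subset_Icc_right ht'.2)
    · simp only [Pi.zero_apply, companion_zero]
      exact hasDerivWithinAt_const t (Iic t) (0 : Fin m → ℝ)
  funext x
  have hVx : V x = 0 := by
    rcases le_total (x : ℝ) x₀ with h | h
    · exact hleft ⟨x.2.1, h⟩
    · exact hright ⟨h, x.2.2⟩
  exact (der_zero hab f x).symm.trans (congrFun hVx ⟨0, hm⟩)

/-! ### The operator `L` with values in `L²[a, b]` -/

/-- Evaluation at a point of the derivative of order `j < m`, as a linear functional on `H^m`. -/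
noncomputable def derL (hab : a < b) {m j : ℕ} (hj : j < m) {x : ℝ} (hx : x ∈ Icc a b) :
    Sobolev hab m →ₗ[ℝ] ℝ where
  toFun f := der hab j f x
  map_add' f g := der_add hab (f.2.1 j hj).1 (g.2.1 j hj).1 hx
  map_smul' c f := by
    rw [Submodule.coe_smul, der_smul]; rfl

theorem memLp_of_continuousOn {f : ℝ → ℝ} (hf : ContinuousOn f (Icc a b)) :
    MemLp f 2 (volume.restrict (Icc a b)) := by
  obtain ⟨C, hC⟩ := isCompact_Icc.exists_bound_of_continuousOn hf
  exact MemLp.of_bound (hf.aestronglyMeasurable measurableSet_Icc) C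
    ((ae_restrict_iff' measurableSet_Icc).2 (.of_forall hC))

theorem memLp_continuousOn_mul {f g : ℝ → ℝ} (hf : ContinuousOn f (Icc a b))
    (hg : MemLp g 2 (volume.restrict (Icc a b))) :
    MemLp (fun x => f x * g x) 2 (volume.restrict (Icc a b)) := by
  obtain ⟨C, hC⟩ := isCompact_Icc.exists_bound_of_continuousOn hf
  refine hg.of_le_mul ((hf.aestronglyMeasurable measurableSet_Icc).mul hg.1) (c := C)
    ((ae_restrict_iff' measurableSet_Icc).2 (.of_forall fun x hx => ?_))
  rw [norm_mul]
  exact mul_le_mul_of_nonneg_right (hC x hx) (norm_nonneg _)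

theorem MemSobolev.memLp_diffOp {w : Fin m → ℝ → ℝ} (hw : ∀ j, ContinuousOn (w j) (Icc a b))
    {f : Icc a b → ℝ} (hf : MemSobolev hab m f) :
    MemLp (diffOp hab w f) 2 (volume.restrict (Icc a b)) :=
  hf.2.add (memLp_finsetSum _ fun j _ =>
    memLp_of_continuousOn ((hw j).mul (hf.continuousOn_der j.2)))

/-- The operator `L` as a linear map from `H^m[a, b]` to `L²[a, b]`. -/
noncomputable def diffOpL (hab : a < b) {w : Fin m → ℝ → ℝ}
    (hw : ∀ j, ContinuousOn (w j) (Icc a b)) :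
    Sobolev hab m →ₗ[ℝ] Lp ℝ 2 (volume.restrict (Icc a b)) where
  toFun f := (MemSobolev.memLp_diffOp hw f.2).toLp _
  map_add' f g := by
    rw [← MemLp.toLp_add, MemLp.toLp_eq_toLp_iff]
    filter_upwards [MemSobolev.der_add_ae f.2 g.2, ae_restrict_mem measurableSet_Icc] with x hx hxI
    have hj : ∀ j : Fin m, der hab j ((f : Icc a b → ℝ) + g) x = der hab j f x + der hab j g x :=
      fun j => der_add hab (f.2.1 j j.2).1 (g.2.1 j j.2).1 hxI
    simp only [diffOp, Submodule.coe_add, Pi.add_apply, hj, mul_add, Finset.sum_add_distrib] at hx ⊢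
    rw [hx]
    ring
  map_smul' c f := by
    rw [RingHom.id_apply, ← MemLp.toLp_const_smul]
    congr 1
    funext x
    simp only [diffOp, Submodule.coe_smul, der_smul, Pi.smul_apply, smul_eq_mul, mul_add,
      Finset.mul_sum]
    congr 1
    exact Finset.sum_congr rfl fun j _ => by ring

theorem coeFn_diffOpL {w : Fin m → ℝ → ℝ} (hw : ∀ j, ContinuousOn (w j) (Icc a b))
    (f : Sobolev hab m) : diffOpL hab hw f =ᵐ[volume.restrict (Icc a b)] diffOp hab w f :=
  MemLp.coeFn_toLp (MemSobolev.memLp_diffOp hw f.2)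

theorem diffOpL_eq_iff {w : Fin m → ℝ → ℝ} (hw : ∀ j, ContinuousOn (w j) (Icc a b))
    (f : Sobolev hab m) (φ : Lp ℝ 2 (volume.restrict (Icc a b))) :
    diffOpL hab hw f = φ ↔ diffOp hab w f =ᵐ[volume.restrict (Icc a b)] φ := by
  rw [Lp.ext_iff]
  exact ⟨fun h => (coeFn_diffOpL hw f).symm.trans h, fun h => (coeFn_diffOpL hw f).trans h⟩

theorem diffOpL_eq_zero_iff {w : Fin m → ℝ → ℝ} (hw : ∀ j, ContinuousOn (w j) (Icc a b))
    (f : Sobolev hab m) :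
    diffOpL hab hw f = 0 ↔ ∀ᵐ x ∂(volume.restrict (Icc a b)), diffOp hab w f x = 0 := by
  rw [Lp.eq_zero_iff_ae_eq_zero]
  exact ⟨fun h => (coeFn_diffOpL hw f).symm.trans h, fun h => (coeFn_diffOpL hw f).trans h⟩

/-- An element of `H^m` is determined by `L f` and the values at `a` of its derivatives of order
`j < m`. -/
theorem sobolev_ext (hm : 0 < m) {w : Fin m → ℝ → ℝ} (hw : ∀ j, ContinuousOn (w j) (Icc a b))
    {f g : Sobolev hab m} (hL : diffOpL hab hw f = diffOpL hab hw g)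
    (hj : ∀ j < m, der hab j f a = der hab j g a) : f = g := by
  rw [← sub_eq_zero, ← map_sub, diffOpL_eq_zero_iff] at hL
  rw [← sub_eq_zero]
  refine Subtype.ext (eq_zero_of_diffOp_ae_eq_zero hm hw (f - g).2 hL (left_mem_Icc.2 hab.le)
    fun j hjm => ?_)
  have := map_sub (derL hab hjm (left_mem_Icc.2 hab.le)) f g
  exact this.trans (sub_eq_zero.2 (hj j hjm))

/-! ### The Wronskian matrix -/

/-- A singular Wronskian would give a nontrivial combination of the `u_i` with vanishing
derivatives of order `j < m` at `x`, which is zero by uniqueness, against independence. -/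
theorem isUnit_det_wronskian (hm : 0 < m) {w : Fin m → ℝ → ℝ}
    (hw : ∀ j, ContinuousOn (w j) (Icc a b)) {u : Fin m → Sobolev hab m}
    (hu : LinearIndependent ℝ u) (hL : ∀ i, diffOpL hab hw (u i) = 0) {x : ℝ}
    (hx : x ∈ Icc a b) : IsUnit (wronskian hab u x).det := by
  rw [isUnit_iff_ne_zero]
  intro hdet
  obtain ⟨c, hc, hcW⟩ := Matrix.exists_vecMul_eq_zero_iff.2 hdet
  set f : Sobolev hab m := ∑ i, c i • u i with hf
  have hLf : diffOpL hab hw f = 0 := by simp [hf, hL]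
  have hzero : ∀ j < m, der hab j f x = 0 := by
    intro j hj
    have h1 : derL hab hj hx f = ∑ i, c i * der hab j (u i) x := by
      rw [hf, map_sum]
      exact Finset.sum_congr rfl fun i _ => by rw [map_smul]; rfl
    exact h1.trans (congrFun hcW ⟨j, hj⟩)
  have hf0 : f = 0 := Subtype.ext
    (eq_zero_of_diffOp_ae_eq_zero hm hw f.2 ((diffOpL_eq_zero_iff hw f).1 hLf) hx hzero)
  exact hc (funext (Fintype.linearIndependent_iff.1 hu c hf0))

/-- The function `u*_i`: the `i`-th entry of the last row of the inverse Wronskian matrix. -/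
noncomputable def adjointSol (hab : a < b) (hm : 0 < m) (u : Fin m → Sobolev hab m) (i : Fin m)
    (x : ℝ) : ℝ :=
  (wronskian hab u x)⁻¹ ⟨m - 1, Nat.sub_lt hm one_pos⟩ i

theorem continuousOn_adjointSol (hm : 0 < m) {u : Fin m → Sobolev hab m}
    (hW : ∀ x ∈ Icc a b, IsUnit (wronskian hab u x).det) (i : Fin m) :
    ContinuousOn (adjointSol hab hm u i) (Icc a b) := by
  have hc : Continuous fun x : Icc a b => wronskian hab u x :=
    continuous_matrix fun i j => continuousOn_iff_continuous_domRestrict.1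
      (MemSobolev.continuousOn_der (u i).2 j.2)
  rw [continuousOn_iff_continuous_domRestrict]
  have h : (Icc a b).domRestrict (adjointSol hab hm u i) = fun x : Icc a b =>
      (wronskian hab u x).det⁻¹ *
        (wronskian hab u x).adjugate ⟨m - 1, Nat.sub_lt hm one_pos⟩ i := by
    funext x
    simp [adjointSol, Matrix.inv_def, domRestrict]
  rw [h]
  exact (hc.matrix_det.inv₀ fun x => (hW x x.2).ne_zero).mul (hc.matrix_adjugate.matrix_elem _ _)

/-- The last row of `W⁻¹ W = 1`: this is the system solved by variation of constants. -/
theorem sum_der_mul_adjointSol (hm : 0 < m) {u : Fin m → Sobolev hab m} {x : ℝ}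
    (hW : IsUnit (wronskian hab u x).det) {j : ℕ} (hj : j < m) :
    ∑ i, der hab j (u i) x * adjointSol hab hm u i x = if j + 1 = m then 1 else 0 := by
  have h := congrFun (congrFun (Matrix.nonsing_inv_mul _ hW) ⟨m - 1, Nat.sub_lt hm one_pos⟩) ⟨j, hj⟩
  rw [Matrix.mul_apply, Matrix.one_apply] at h
  have hiff : (⟨m - 1, Nat.sub_lt hm one_pos⟩ : Fin m) = ⟨j, hj⟩ ↔ j + 1 = m := by
    rw [Fin.mk.injEq]; omega
  simp only [hiff] at h
  rw [← h]
  exact Finset.sum_congr rfl fun i _ => mul_comm _ _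

/-! ### The Green's function and variation of constants -/

theorem intervalIntegrable_of_memLp (hab : a < b) {f : ℝ → ℝ}
    (hf : MemLp f 2 (volume.restrict (Icc a b))) : IntervalIntegrable f volume a b := by
  rw [intervalIntegrable_iff_integrableOn_Icc_of_le hab.le]
  exact hf.integrable one_le_two

theorem green_eq_indicator (hm : 0 < m) (u : Fin m → Sobolev hab m) (t : Icc a b) :
    green hab hm u t = {x | x ≤ (t : ℝ)}.indicator
      (fun x => ∑ i, (u i : Icc a b → ℝ) t * adjointSol hab hm u i x) := by
  funext x
  simp only [green, indicator, mem_ofPred_eq, adjointSol]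

theorem memLp_green (hm : 0 < m) {u : Fin m → Sobolev hab m}
    (hW : ∀ x ∈ Icc a b, IsUnit (wronskian hab u x).det) (t : Icc a b) :
    MemLp (green hab hm u t) 2 (volume.restrict (Icc a b)) := by
  rw [green_eq_indicator]
  exact (memLp_of_continuousOn (continuousOn_finsetSum _ fun i _ =>
    continuousOn_const.mul (continuousOn_adjointSol hm hW i))).indicator measurableSet_Iic

theorem intervalIntegrable_mul (hab : a < b) {f g : ℝ → ℝ}
    (hf : MemLp f 2 (volume.restrict (Icc a b))) (hg : MemLp g 2 (volume.restrict (Icc a b))) :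
    IntervalIntegrable (fun x => f x * g x) volume a b := by
  rw [intervalIntegrable_iff_integrableOn_Icc_of_le hab.le]
  exact hf.integrable_mul hg

theorem integral_green_mul (hm : 0 < m) {u : Fin m → Sobolev hab m}
    (hW : ∀ x ∈ Icc a b, IsUnit (wronskian hab u x).det) {φ : ℝ → ℝ}
    (hφ : MemLp φ 2 (volume.restrict (Icc a b))) (t : Icc a b) :
    ∫ x in a..b, green hab hm u t x * φ x =
      ∑ i, (u i : Icc a b → ℝ) t * ∫ x in a..t, adjointSol hab hm u i x * φ x := by
  have h1 : (fun x => green hab hm u t x * φ x) = {x | x ≤ (t : ℝ)}.indicator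
      (fun x => ∑ i, (u i : Icc a b → ℝ) t * (adjointSol hab hm u i x * φ x)) := by
    funext x
    rw [green_eq_indicator]
    by_cases hx : x ≤ (t : ℝ)
    · simp [indicator, hx, Finset.sum_mul, mul_assoc]
    · simp [indicator, hx]
  rw [h1, intervalIntegral.integral_indicator t.2, intervalIntegral.integral_finsetSum]
  · simp only [intervalIntegral.integral_const_mul]
  · intro i _
    refine ((intervalIntegrable_of_memLp hab
      (memLp_continuousOn_mul (continuousOn_adjointSol hm hW i) hφ)).mono_set ?_).const_mul _
    rw [uIcc_of_le t.2.1, uIcc_of_le hab.le]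
    exact Icc_subset_Icc_right t.2.2

theorem absolutelyContinuousOnInterval_sum {ι : Type*} (s : Finset ι) {f : ι → ℝ → ℝ}
    (hf : ∀ i ∈ s, AbsolutelyContinuousOnInterval (f i) a b) :
    AbsolutelyContinuousOnInterval (fun x => ∑ i ∈ s, f i x) a b := by
  classical
  induction s using Finset.induction_on with
  | empty =>
    simpa using (contDiffOn_const (c := (0 : ℝ))).absolutelyContinuousOnInterval
  | insert i s his ih =>
    simp only [Finset.sum_insert his]
    exact (hf i (Finset.mem_insert_self i s)).add
      (ih fun k hk => hf k (Finset.mem_insert_of_mem hk))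

/-- Variation of constants: the functions `g_j = ∑ i, u_i^(j) ∫_a^· u*_i φ`, with `φ` added when
`j = m`, are the successive derivatives of `∫_a^b G(·, x) φ(x) dx`. -/
theorem exists_sobolev_integral_green (hm : 0 < m) {w : Fin m → ℝ → ℝ}
    (hw : ∀ j, ContinuousOn (w j) (Icc a b)) {u : Fin m → Sobolev hab m}
    (hL : ∀ i, diffOpL hab hw (u i) = 0)
    (hW : ∀ x ∈ Icc a b, IsUnit (wronskian hab u x).det) {φ : ℝ → ℝ}
    (hφ : MemLp φ 2 (volume.restrict (Icc a b))) :
    ∃ f : Sobolev hab m, (∀ t, (f : Icc a b → ℝ) t = ∫ x in a..b, green hab hm u t x * φ x) ∧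
      (∀ j < m, der hab j f a = 0) ∧ diffOp hab w f =ᵐ[volume.restrict (Icc a b)] φ := by
  set c : Fin m → ℝ → ℝ := fun i t => ∫ x in a..t, adjointSol hab hm u i x * φ x with hc
  have hint : ∀ i, IntervalIntegrable (fun x => adjointSol hab hm u i x * φ x) volume a b :=
    fun i => intervalIntegrable_of_memLp hab
      (memLp_continuousOn_mul (continuousOn_adjointSol hm hW i) hφ)
  have hcac : ∀ i, AbsolutelyContinuousOnInterval (c i) a b := fun i =>
    (hint i).absolutelyContinuousOnInterval_intervalIntegral (by simp)
  have hccont : ∀ i, ContinuousOn (c i) (Icc a b) := fun i => by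
    have := (hcac i).continuousOn
    rwa [uIcc_of_le hab.le] at this
  have hcd : ∀ i, ∀ᵐ x, x ∈ Icc a b → HasDerivAt (c i) (adjointSol hab hm u i x * φ x) x := by
    intro i
    have := (hint i).ae_hasDerivAt_integral
    rw [uIcc_of_le hab.le] at this
    filter_upwards [this] with x hx hxI using hx hxI a (left_mem_Icc.2 hab.le)
  set g : ℕ → ℝ → ℝ := fun j x =>
    ∑ i, der hab j (u i) x * c i x + if j = m then φ x else 0 with hg
  have hglt : ∀ j < m, g j = fun x => ∑ i, der hab j (u i) x * c i x := fun j hj => by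
    funext x; simp [hg, hj.ne]
  obtain ⟨hmem, hder, hderm⟩ := memSobolev_of_chain hab m
    (f := fun t => ∫ x in a..b, green hab hm u t x * φ x) g
    (fun x => by
      rw [integral_green_mul hm hW hφ, hglt 0 hm]
      simp only [der_zero, hc])
    (fun j hj => by
      rw [hglt j hj]
      exact absolutelyContinuousOnInterval_sum _ fun i _ => ((u i).2.1 j hj).2.fun_mul (hcac i))
    (fun j hj => by
      rw [hglt j hj]
      filter_upwards [ae_all_iff.2 fun i => MemSobolev.ae_hasDerivAt_der (u i).2 hj,
        ae_all_iff.2 hcd] with x hx1 hx2 hxI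
      refine (HasDerivAt.fun_sum fun i _ => (hx1 i hxI).mul (hx2 i hxI)).congr_deriv ?_
      have hs := sum_der_mul_adjointSol hm (hW x hxI) hj
      simp only [hg, Finset.sum_add_distrib, ← mul_assoc, ← Finset.sum_mul, hs]
      split_ifs <;> simp)
    (by
      simp only [hg, if_true]
      refine (memLp_finsetSum _ fun i _ => ?_).add hφ
      simpa only [mul_comm] using memLp_continuousOn_mul (hccont i) (u i).2.2)
  refine ⟨⟨_, hmem⟩, fun t => rfl, fun j hj => ?_, ?_⟩
  · rw [hder j hj (left_mem_Icc.2 hab.le), hglt j hj]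
    simp [hc]
  · filter_upwards [hderm, ae_all_iff.2 fun i => (diffOpL_eq_zero_iff hw (u i)).1 (hL i),
      ae_restrict_mem measurableSet_Icc] with x hx hx0 hxI
    have hj : ∀ j : Fin m, der hab j
        (fun t : Icc a b => ∫ x in a..b, green hab hm u t x * φ x) x =
        ∑ i, der hab j (u i) x * c i x := fun j => by
      rw [hder j j.2 hxI, hglt j j.2]
    simp only [diffOp, hx, hj, hg, if_true, Finset.mul_sum]
    rw [Finset.sum_comm, add_right_comm, ← Finset.sum_add_distrib]
    refine (congrArg (· + φ x) (Finset.sum_eq_zero fun i _ => ?_)).trans (zero_add _)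
    have := congrArg (· * c i x) (hx0 i)
    simp only [diffOp, add_mul, Finset.sum_mul, zero_mul] at this
    simpa only [mul_assoc] using this

/-- The integral operator `φ ↦ ∫_a^b G(·, x) φ(x) dx` from `L²[a, b]` to `H^m[a, b]`, the right
inverse of `L` with zero initial data. -/
theorem exists_greenOperator (hm : 0 < m) {w : Fin m → ℝ → ℝ}
    (hw : ∀ j, ContinuousOn (w j) (Icc a b)) {u : Fin m → Sobolev hab m}
    (hL : ∀ i, diffOpL hab hw (u i) = 0)
    (hW : ∀ x ∈ Icc a b, IsUnit (wronskian hab u x).det) :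
    ∃ T : Lp ℝ 2 (volume.restrict (Icc a b)) →ₗ[ℝ] Sobolev hab m,
      (∀ φ t, (T φ : Icc a b → ℝ) t = ∫ x in a..b, green hab hm u t x * φ x) ∧
      (∀ φ, ∀ j < m, der hab j (T φ) a = 0) ∧ ∀ φ, diffOpL hab hw (T φ) = φ := by
  choose T hT hT0 hTL using fun φ : Lp ℝ 2 (volume.restrict (Icc a b)) =>
    exists_sobolev_integral_green hm hw hL hW (Lp.memLp φ)
  have hTL' : ∀ φ, diffOpL hab hw (T φ) = φ := fun φ => (diffOpL_eq_iff hw _ _).2 (hTL φ)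
  have ha := left_mem_Icc.2 hab.le
  refine ⟨⟨⟨T, fun φ ψ => sobolev_ext hm hw ?_ fun j hj => ?_⟩, fun r φ =>
    sobolev_ext hm hw ?_ fun j hj => ?_⟩, hT, hT0, hTL'⟩
  · simp only [map_add, hTL']
  · have h1 : der hab j (T φ + T ψ : Sobolev hab m) a = _ := map_add (derL hab hj ha) (T φ) (T ψ)
    rw [hT0 _ j hj, h1]
    simp [derL, hT0 _ j hj]
  · simp only [map_smul, hTL', RingHom.id_apply]
  · have h1 : der hab j (r • T φ : Sobolev hab m) a = _ := map_smul (derL hab hj ha) r (T φ)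
    rw [hT0 _ j hj, RingHom.id_apply]
    rw [h1]
    simp [derL, hT0 _ j hj]

/-! ### Representers and orthogonal decomposition -/

theorem integral_mul_eq_inner (hab : a < b) {f g : ℝ → ℝ}
    {φ ψ : Lp ℝ 2 (volume.restrict (Icc a b))} (hf : f =ᵐ[volume.restrict (Icc a b)] φ)
    (hg : g =ᵐ[volume.restrict (Icc a b)] ψ) : ∫ x in a..b, f x * g x = ⟪φ, ψ⟫ := by
  rw [L2.inner_def, intervalIntegral.integral_of_le hab.le, ← integral_Icc_eq_integral_Ioc]
  refine integral_congr_ae ?_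
  filter_upwards [hf, hg] with x h1 h2
  rw [h1, h2, real_inner_eq_re_inner, RCLike.inner_apply]
  simp [mul_comm]

theorem normL_eq_norm_diffOpL {w : Fin m → ℝ → ℝ} (hw : ∀ j, ContinuousOn (w j) (Icc a b))
    {f : Sobolev hab m} (hf : ∀ j < m, der hab j f a = 0) :
    normL hab w f = ‖diffOpL hab hw f‖ := by
  have h := coeFn_diffOpL hw f
  rw [normL, innerL, integral_mul_eq_inner hab h.symm h.symm, real_inner_self_eq_norm_sq]
  simp [hf]

/-- Riesz representation: on functions with zero initial data the norm of `H^m` is the `L²` norm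
of `L f`, so a continuous functional is represented there by an element of `L²`. -/
theorem exists_representer {w : Fin m → ℝ → ℝ} (hw : ∀ j, ContinuousOn (w j) (Icc a b))
    {T : Lp ℝ 2 (volume.restrict (Icc a b)) →ₗ[ℝ] Sobolev hab m}
    (hT0 : ∀ φ, ∀ j < m, der hab j (T φ) a = 0) (hTL : ∀ φ, diffOpL hab hw (T φ) = φ)
    {F : Sobolev hab m →ₗ[ℝ] ℝ} (hF : ContinuousFunctional hab w F) :
    ∃ ψ : Lp ℝ 2 (volume.restrict (Icc a b)), ∀ φ, F (T φ) = ⟪ψ, φ⟫ := by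
  have hcont : Continuous (F ∘ₗ T) := by
    refine continuous_of_continuousAt_zero (F ∘ₗ T) (Metric.continuousAt_iff.2 fun ε hε => ?_)
    obtain ⟨δ, hδ, h⟩ := hF 0 ε hε
    refine ⟨δ, hδ, fun {φ} hφ => ?_⟩
    have := h (T φ) (by rwa [sub_zero, normL_eq_norm_diffOpL hw (hT0 φ), hTL, ← dist_zero_right])
    simpa [Real.dist_eq] using this
  refine ⟨(InnerProductSpace.toDual ℝ _).symm ⟨F ∘ₗ T, hcont⟩, fun φ => ?_⟩
  rw [InnerProductSpace.toDual_symm_apply]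
  rfl

/-- If `T` is a right inverse of `L`, every vector is the sum of an element of `ker L`, a
combination of the `T ψ_j`, and some `T r` with `r` orthogonal to all the `ψ_j`. -/
theorem exists_decomposition {V E ι κ : Type*} [AddCommGroup V] [Module ℝ V]
    [NormedAddCommGroup E] [InnerProductSpace ℝ E] [Fintype ι] [Fintype κ]
    {L : V →ₗ[ℝ] E} {T : E →ₗ[ℝ] V} (hTL : ∀ φ, L (T φ) = φ) {u : ι → V}
    (hu : ∀ f, L f = 0 → f ∈ Submodule.span ℝ (range u)) (ψ : κ → E) (μ : V) :
    ∃ (α : ι → ℝ) (β : κ → ℝ) (r : E),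
      μ = ∑ i, α i • u i + ∑ j, β j • T (ψ j) + T r ∧ ∀ j, ⟪ψ j, r⟫ = 0 := by
  obtain ⟨α, hα⟩ := (Submodule.mem_span_range_iff_exists_fun ℝ).1
    (hu (μ - T (L μ)) (by rw [map_sub, hTL, sub_self]))
  set S := Submodule.span ℝ (range ψ)
  have : FiniteDimensional ℝ S := FiniteDimensional.span_of_finite ℝ (finite_range ψ)
  obtain ⟨β, hβ⟩ := (Submodule.mem_span_range_iff_exists_fun ℝ).1 (S.starProjection_apply_mem (L μ))
  refine ⟨α, β, L μ - S.starProjection (L μ), ?_, fun j => ?_⟩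
  · rw [hα, map_sub, ← hβ, map_sum]
    simp only [map_smul]
    abel
  · exact (Submodule.sub_starProjection_mem_orthogonal (L μ)) _
      (Submodule.subset_span (mem_range_self j))

theorem matrixK_eq_gram {E : Type*} [NormedAddCommGroup E] [InnerProductSpace ℝ E]
    {T : E →ₗ[ℝ] Sobolev hab m} {F : Fin n → (Sobolev hab m →ₗ[ℝ] ℝ)} {ψ : Fin n → E}
    (hψ : ∀ j φ, F j (T φ) = ⟪ψ j, φ⟫) :
    matrixK F (fun j => T (ψ j)) = Matrix.gram ℝ ψ := by
  ext j k
  simp [matrixK, hψ, Matrix.gram_apply]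

/-- For representers `ψ_j`, so that `K` is their Gram matrix, this identifies `β' K β` with the penalty
`∫_a^b (L μ)²` of `μ = ∑ j, β_j T ψ_j`. -/
theorem dotProduct_gram_mulVec {E : Type*} [NormedAddCommGroup E] [InnerProductSpace ℝ E]
    (ψ : Fin n → E) (β : Fin n → ℝ) :
    β ⬝ᵥ (Matrix.gram ℝ ψ).mulVec β = ‖∑ j, β j • ψ j‖ ^ 2 := by
  rw [← real_inner_self_eq_norm_sq]
  simp only [sum_inner, inner_sum, real_inner_smul_left, real_inner_smul_right, dotProduct,
    Matrix.mulVec, Matrix.gram_apply, Finset.mul_sum]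
  exact Finset.sum_congr rfl fun i _ => Finset.sum_congr rfl fun j _ => by
    rw [real_inner_comm]; ring

/-- The penalized objective splits: `T r` with `r` orthogonal to the representers `ψ_j` is
invisible to the functionals `F_j` and only adds `lam ‖r‖²` to the penalty. -/
theorem objective_combination_add {w : Fin m → ℝ → ℝ} (hw : ∀ j, ContinuousOn (w j) (Icc a b))
    {u : Fin m → Sobolev hab m} (hL : ∀ i, diffOpL hab hw (u i) = 0)
    {T : Lp ℝ 2 (volume.restrict (Icc a b)) →ₗ[ℝ] Sobolev hab m}
    (hTL : ∀ φ, diffOpL hab hw (T φ) = φ)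
    {F : Fin n → (Sobolev hab m →ₗ[ℝ] ℝ)} {ψ : Fin n → Lp ℝ 2 (volume.restrict (Icc a b))}
    (hψ : ∀ j φ, F j (T φ) = ⟪ψ j, φ⟫)
    (G : (Fin n → Icc a b) → (Fin n → ℝ) → (Fin n → ℝ) → ℝ) (t : Fin n → Icc a b) (Y : Fin n → ℝ)
    (lam : ℝ) (α : Fin m → ℝ) (β : Fin n → ℝ) {r : Lp ℝ 2 (volume.restrict (Icc a b))}
    (hr : ∀ j, ⟪ψ j, r⟫ = 0) :
    objective hab w G t Y F lam (combination u (fun j => T (ψ j)) α β + T r) =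
      finObjective u G t Y F (fun j => T (ψ j)) lam (α, β) + lam * ‖r‖ ^ 2 := by
  set μ := combination u (fun j => T (ψ j)) α β + T r with hμ
  have hLμ : diffOpL hab hw μ = ∑ j, β j • ψ j + r := by
    simp [hμ, combination, hL, hTL]
  have hFμ : ∀ j, F j μ = F j (combination u (fun j => T (ψ j)) α β) := fun j => by
    rw [hμ, map_add, hψ, hr, add_zero]
  have hpen : ∫ x in a..b, (diffOp hab w μ x) ^ 2 = ‖∑ j, β j • ψ j‖ ^ 2 + ‖r‖ ^ 2 := by
    have h := (coeFn_diffOpL hw μ).symm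
    simp only [sq (diffOp hab w μ _)]
    rw [integral_mul_eq_inner hab h h, hLμ, real_inner_self_eq_norm_sq, sq, sq, sq]
    refine norm_add_sq_eq_norm_sq_add_norm_sq_real ?_
    simp [sum_inner, real_inner_smul_left, hr]
  simp only [objective, finObjective, hFμ, hpen, matrixK_eq_gram hψ, dotProduct_gram_mulVec]
  ring


end DiffPenalty

theorem mainTheorem3 {a b : ℝ} (hab : a < b) {m : ℕ} (hm : 0 < m)
    (w : Fin m → ℝ → ℝ) (hw : ∀ j, ContinuousOn (w j) (Icc a b))
    (u : Fin m → Sobolev hab m) (hu_indep : LinearIndependent ℝ u)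
    (hu_span : ∀ f : Sobolev hab m, f ∈ Submodule.span ℝ (range u) ↔
      ∀ᵐ x ∂(volume.restrict (Icc a b)), diffOp hab w f x = 0)
    {n : ℕ} (G : (Fin n → Icc a b) → (Fin n → ℝ) → (Fin n → ℝ) → ℝ)
    (t : Fin n → Icc a b) (Y : Fin n → ℝ)
    (F : Fin n → (Sobolev hab m →ₗ[ℝ] ℝ)) (hF : ∀ j, ContinuousFunctional hab w (F j))
    {lam : ℝ} (hlam : 0 ≤ lam) :
    IsGreenFunction hab w (green hab hm u) ∧
    ∃ hR : ∀ s : Icc a b, (fun r => kernelR hab hm u r s) ∈ Sobolev hab m,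
    ∃ η : Fin n → Sobolev hab m,
      (∀ (j : Fin n) (s : Icc a b),
        (η j : Icc a b → ℝ) s = F j ⟨fun r => kernelR hab hm u r s, hR s⟩) ∧
      (matrixK F η).PosSemidef ∧
      (0 < lam → ∀ μ : Sobolev hab m, IsMinOn (objective hab w G t Y F lam) univ μ →
        ∃ (α : Fin m → ℝ) (β : Fin n → ℝ), μ = combination u η α β ∧
          IsMinOn (finObjective u G t Y F η lam) univ (α, β)) ∧
      (∀ (α : Fin m → ℝ) (β : Fin n → ℝ),
        IsMinOn (finObjective u G t Y F η lam) univ (α, β) →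
          IsMinOn (objective hab w G t Y F lam) univ (combination u η α β)) := by
  have hL : ∀ i, diffOpL hab hw (u i) = 0 := fun i => (diffOpL_eq_zero_iff hw _).2
    ((hu_span _).1 (Submodule.subset_span (mem_range_self i)))
  have hW : ∀ x ∈ Icc a b, IsUnit (wronskian hab u x).det := fun x hx =>
    isUnit_det_wronskian hm hw hu_indep hL hx
  obtain ⟨T, hT, hT0, hTL⟩ := exists_greenOperator hm hw hL hW
  choose ψ hψ using fun j => exists_representer hw hT0 hTL (hF j)
  set γ : Icc a b → Lp ℝ 2 (volume.restrict (Icc a b)) := fun s => (memLp_green hm hW s).toLp _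
    with hγ
  have hγ_ae : ∀ s, green hab hm u s =ᵐ[volume.restrict (Icc a b)] γ s := fun s =>
    (memLp_green hm hW s).coeFn_toLp.symm
  have hTγ : ∀ φ s, (T φ : Icc a b → ℝ) s = inner ℝ (γ s) φ := fun φ s => by
    rw [hT]
    exact integral_mul_eq_inner hab (hγ_ae s) (Filter.EventuallyEq.refl _ _)
  -- `R₁(·, s)` is the image of `G(s, ·)` under the integral operator.
  have hker : ∀ s, (fun r => kernelR hab hm u r s) = (T (γ s) : Icc a b → ℝ) := fun s => by
    funext r
    rw [hTγ]
    exact integral_mul_eq_inner hab (hγ_ae r) (hγ_ae s)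
  have hsplit := objective_combination_add hw hL hTL hψ G t Y lam
  have hcomb : ∀ α β, objective hab w G t Y F lam (combination u (fun j => T (ψ j)) α β) =
      finObjective u G t Y F (fun j => T (ψ j)) lam (α, β) := fun α β => by
    simpa using hsplit α β (r := 0) (by simp)
  have hdecomp := exists_decomposition hTL
    (fun f hf => (hu_span f).2 ((diffOpL_eq_zero_iff hw f).1 hf)) ψ
  refine ⟨fun f hf s => ⟨intervalIntegrable_mul hab (memLp_green hm hW s)
    (MemSobolev.memLp_diffOp hw f.2), ?_⟩, fun s => (hker s).symm ▸ (T (γ s)).2,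
    fun j => T (ψ j), fun j s => ?_, ?_, ?_, ?_⟩
  · have hfT : f = T (diffOpL hab hw f) := sobolev_ext hm hw (hTL _).symm fun j hj => by
      rw [hf j hj, hT0 _ j hj]
    rw [integral_mul_eq_inner hab (hγ_ae s) (coeFn_diffOpL hw f).symm, ← hTγ, ← hfT]
  · rw [hTγ, real_inner_comm, ← hψ]
    exact congrArg (F j) (Subtype.ext (hker s).symm)
  · rw [matrixK_eq_gram hψ]
    exact Matrix.posSemidef_gram ℝ ψ
  · intro hpos μ hμ
    obtain ⟨α, β, r, hdec, hr⟩ := hdecomp μ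
    have hμr : objective hab w G t Y F lam μ =
        finObjective u G t Y F (fun j => T (ψ j)) lam (α, β) + lam * ‖r‖ ^ 2 := by
      rw [hdec]; exact hsplit α β hr
    have hle : ∀ α' β', finObjective u G t Y F (fun j => T (ψ j)) lam (α, β) + lam * ‖r‖ ^ 2 ≤
        finObjective u G t Y F (fun j => T (ψ j)) lam (α', β') := fun α' β' => by
      rw [← hμr, ← hcomb]
      exact hμ (mem_univ _)
    -- Comparing `μ` with its own projection, which has the same values `F_j`, forces `r = 0`.
    have hr0 : r = 0 := by
      have h1 : lam * ‖r‖ ^ 2 ≤ 0 := by linarith [hle α β]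
      have h2 : ‖r‖ ^ 2 ≤ 0 := nonpos_of_mul_nonpos_right h1 hpos
      exact norm_eq_zero.1 (pow_eq_zero_iff two_ne_zero |>.1 (le_antisymm h2 (sq_nonneg _)))
    refine ⟨α, β, ?_, fun p _ => ?_⟩
    · rw [hdec, hr0, map_zero, add_zero]; rfl
    · have := hle p.1 p.2
      rw [hr0, norm_zero] at this
      simpa using this
  · intro α β hmin μ _
    obtain ⟨α', β', r, hdec, hr⟩ := hdecomp μ
    have h2 : objective hab w G t Y F lam μ =
        finObjective u G t Y F (fun j => T (ψ j)) lam (α', β') + lam * ‖r‖ ^ 2 := by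
      rw [hdec]; exact hsplit α' β' hr
    have h3 : finObjective u G t Y F (fun j => T (ψ j)) lam (α, β) ≤
        finObjective u G t Y F (fun j => T (ψ j)) lam (α', β') := hmin (mem_univ (α', β'))
    rw [mem_ofPred_eq, hcomb, h2]
    exact h3.trans (le_add_of_nonneg_right (by positivity))
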